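/- Let $G=\langle a,b,c,d \mid aba^{-1}b^{-1}cdc^{-1}d^{-1}=1\rangle$ be the fundamental group of the closed orientable surface of genus $2$, let $\Gamma$ be its (undirected) Cayley graph with respect to the generators $a,b,c,d$, and let $v_0$ be the vertex of $\Gamma$ corresponding to the identity of $G$. For vertices $u,v$ of $\Gamma$, the snake from $u$ to $v$ is the subgraph of $\Gamma$ that is the union of all shortest edgepaths from $u$ to $v$; its length is the number of edges in such a shortest edgepath. Let $G_2$ be the finite directed multigraph with the ten vertices $\mathrm{St}, A, A', A'', B, C, C', D, E, \mathrm{Fi}$ and the following directed edges, where $X\xrightarrow{k}Y$ means that there are exactly $k$ parallel edges from $X$ to $Y$ (and there are no other edges): - $\mathrm{St}\xrightarrow{8}A$, $\mathrm{St}\xrightarrow{8}B$, $\mathrm{St}\xrightarrow{1}\mathrm{Fi}$; - $A\xrightarrow{5}A$, $A\xrightarrow{2}A'$, $A\xrightarrow{6}B$, $A\xrightarrow{1}\mathrm{Fi}$; - $A'\xrightarrow{5}A$, $A'\xrightarrow{1}A'$, $A'\xrightarrow{1}A''$, $A'\xrightarrow{6}B$, $A'\xrightarrow{1}\mathrm{Fi}$;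 - $A''\xrightarrow{5}A$, $A''\xrightarrow{1}A'$, $A''\xrightarrow{5}B$, $A''\xrightarrow{1}\mathrm{Fi}$; - $B\xrightarrow{1}C$, $C\xrightarrow{1}C'$, $C'\xrightarrow{1}D$, $C'\xrightarrow{2}E$, $E\xrightarrow{1}C$; - $D\xrightarrow{4}A$, $D\xrightarrow{2}A'$, $D\xrightarrow{5}B$, $D\xrightarrow{1}\mathrm{Fi}$. Then for every integer $n\ge 0$, the snakes in $\Gamma$ of length $n$ starting at $v_0$ are in bijective correspondence with the directed paths of length $n+1$ in $G_2$ that start at $\mathrm{St}$ and finish at $\mathrm{Fi}$. (A directed path is a sequence of consecutive directed edges, with vertices and edges allowed to repeat; parallel edges are distinguished.) -/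

import Mathlib

namespace Snakes

/-- The four generators of the fundamental group of the closed orientable surface of genus two. -/
inductive Gen
  | a | b | c | d

/-- The word `a b a⁻¹ b⁻¹ c d c⁻¹ d⁻¹` in the free group on `a, b, c, d`. -/
def relator : FreeGroup Gen :=
  FreeGroup.of Gen.a * FreeGroup.of Gen.b * (FreeGroup.of Gen.a)⁻¹ * (FreeGroup.of Gen.b)⁻¹ *
    FreeGroup.of Gen.c * FreeGroup.of Gen.d * (FreeGroup.of Gen.c)⁻¹ * (FreeGroup.of Gen.d)⁻¹

/-- The group `⟨a, b, c, d | a b a⁻¹ b⁻¹ c d c⁻¹ d⁻¹ = 1⟩`. -/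
abbrev SurfaceGroup : Type := PresentedGroup ({relator} : Set (FreeGroup Gen))

/-- The (undirected) Cayley graph of the group with respect to the generators `a, b, c, d`:
distinct `g` and `h` are adjacent when `h = g * s` or `g = h * s` for a generator `s`. -/
def cayleyGraph : SimpleGraph SurfaceGroup :=
  SimpleGraph.mulCayley (Set.range (fun s : Gen => (PresentedGroup.of s : SurfaceGroup)))

/-- A shortest edgepath: it has the minimal number of edges among all edgepaths with the same
endpoints. -/
def IsShortest {V : Type*} {Γ : SimpleGraph V} {u v : V} (p : Γ.Walk u v) : Prop :=
  ∀ q : Γ.Walk u v, p.length ≤ q.length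

/-- The snake from `u` to `v`: the union (as a subgraph, that is, of vertices and of edges) of all
shortest edgepaths from `u` to `v`. -/
def snake {V : Type*} (Γ : SimpleGraph V) (u v : V) : Γ.Subgraph :=
  ⨆ p : {p : Γ.Walk u v // IsShortest p}, p.1.toSubgraph

/-- The set of snakes of length `n` that start at `u`: the subgraphs which are the snake from `u` to
some vertex `v` for which the shortest edgepaths from `u` to `v` have `n` edges. -/
def snakesFrom {V : Type*} (Γ : SimpleGraph V) (u : V) (n : ℕ) : Set Γ.Subgraph :=
  {H | ∃ v : V, (∃ p : Γ.Walk u v, IsShortest p ∧ p.length = n) ∧ H = snake Γ u v}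

/-- The ten vertices of the directed graph `G₂`. -/
inductive G₂
  | St | A | A' | A'' | B | C | C' | D | E | Fi

namespace G₂

/-- `edgeCount x y` is the number of directed edges of `G₂` from `x` to `y`. -/
def edgeCount : G₂ → G₂ → ℕ
  | St, A => 8
  | St, B => 8
  | St, Fi => 1
  | A, A => 5
  | A, A' => 2
  | A, B => 6
  | A, Fi => 1
  | A', A => 5
  | A', A' => 1
  | A', A'' => 1
  | A', B => 6
  | A', Fi => 1
  | A'', A => 5
  | A'', A' => 1
  | A'', B => 5
  | A'', Fi => 1
  | B, C => 1
  | C, C' => 1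
  | C', D => 1
  | C', E => 2
  | D, A => 4
  | D, A' => 2
  | D, B => 5
  | D, Fi => 1
  | E, C => 1
  | _, _ => 0

/-- `G₂` as a directed multigraph, with `edgeCount x y` parallel edges from `x` to `y`. -/
instance : Quiver G₂ where
  Hom x y := Fin (edgeCount x y)

end G₂

end Snakes

namespace Snakes

/-! The Cayley graph is the 1-skeleton of a tessellation by octagons, eight at each vertex. A snake
from `1` has its endpoint as its only vertex at that distance, so snakes of length `n` correspond to
the vertices at distance `n` (`sphereEquivSnakes`). Both sets in the theorem are finite, so it
suffices to compare cardinalities.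

Every octagon has a lowest vertex and, opposite to it, a top, joined by two ascending sides of four
edges. Deleting the last edge of each right side leaves a spanning tree, whose vertices are the
words accepted by a finite automaton. Labels permute these words, and going once round an octagon is
the identity (`walk_pow_eight`). Hence the group acts on the words, and each element has exactly one
normal form (`evalEquiv`). Crossing an edge raises the length of a normal form by at most one, so
this length is the distance from `1` (`shortest_iff`).

Counting normal forms by shape gives one linear recursion and counting paths in `G₂` another;
`card_pathTo_eq` relates them by induction. -/

/-! ### The automaton of normal forms and the action of labels on them -/

/-- The labels of the eight edges at a vertex of the Cayley graph, in the cyclic order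
`a⁻¹, b, c, d⁻¹, c⁻¹, d, a, b⁻¹` in which the tessellation by octagons arranges them. -/
abbrev Label : Type := Fin 8

namespace Label

/-- The label of the same edge read backwards. -/
def inv (i : Label) : Label := ![6, 7, 4, 5, 2, 3, 0, 1] i

/-- The next label along the octagon to the left of an edge. -/
def left (i : Label) : Label := inv i + 1

/-- The next label along the octagon to the right of an edge. -/
def right (i : Label) : Label := inv i - 1

end Label

/-- The position of a vertex relative to the octagons on the two sides of its downward edge. The
number is the height in the octagon on the named side when this exceeds one; `top` is height four
on the left side. -/
inductive Shape
  | root | mid | left2 | left3 | top | right2 | right3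
  deriving DecidableEq

instance : Fintype Shape where
  elems := {.root, .mid, .left2, .left3, .top, .right2, .right3}
  complete t := by cases t <;> decide

/-- The shape of the vertex reached through the edge that lies `k` places after the downward edge,
or `none` when that edge does not belong to the spanning tree of normal forms. -/
def Shape.step : Shape → Fin 8 → Option Shape
  | root, _ => some mid
  | _, 0 => none
  -- This and the next case are the two ends of the deleted edge, from a `right3` vertex to a `top`
  -- vertex.
  | top, 1 => none
  | right3, 7 => none
  | left2, 1 => some left3
  | left3, 1 => some top
  | _, 1 => some left2
  -- Places 0 and 1 both descend from a `top` vertex, so the next octagon on the left starts at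
  -- place 2.
  | top, 2 => some left2
  | right2, 7 => some right3
  | _, 7 => some right2
  | _, _ => some mid

/-- One step of the automaton that recognises normal forms; its states record the label of the
downward edge and the shape. -/
def next (s : Label × Shape) (i : Label) : Option (Label × Shape) :=
  (s.2.step (i - s.1)).map fun t => (i.inv, t)

/-- The state reached by a word, whose last letter is the head of the list. -/
def state : List Label → Option (Label × Shape)
  -- The label 0 is a dummy: the root has no downward edge and all its edges behave alike.
  | [] => some (0, .root)
  | i :: w => (state w).bind fun s => next s i

/-- Right multiplication of a normal form by a label. -/
def act : List Label → Label → List Label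
  | l :: m :: k :: w, i =>
    if (state (i :: l :: m :: k :: w)).isSome then i :: l :: m :: k :: w
    else if i = l.inv then m :: k :: w
    -- Across a deleted edge, one side of an octagon is exchanged for the other. From `top`, `act w
    -- (k - 1)` descends to the lowest vertex; from `right3`, `act w (k + 1)` climbs from the lowest
    -- vertex to height one on the left side.
    else if i = l.inv + 1 then
      (k - 1).right.right.right :: (k - 1).right.right :: (k - 1).right :: act w (k - 1)
    else (k + 1).left.left.left :: (k + 1).left.left :: (k + 1).left :: act w (k + 1)
  -- No accepted word this short has shape `top` or `right3`, so a rejected label can only cancel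
  -- the last letter.
  | w, i => if (state (i :: w)).isSome then i :: w else w.tail

open Label

theorem inv_inv (i : Label) : i.inv.inv = i := by revert i; decide

theorem state_cons {i : Label} {w : List Label} {s : Label × Shape}
    (h : state (i :: w) = some s) : ∃ s₀, state w = some s₀ ∧ next s₀ i = some s := by
  simpa [state, Option.bind_eq_some_iff] using h

theorem state_cons_of {i : Label} {w : List Label} {s : Label × Shape} (h : state w = some s) :
    state (i :: w) = next s i := by
  simp [state, h]

theorem next_fst {s s' : Label × Shape} {i : Label} (h : next s i = some s') : s'.1 = i.inv := by
  simp only [next, Option.map_eq_some_iff] at h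
  obtain ⟨t, -, rfl⟩ := h
  rfl

theorem act_of_state {i : Label} {w : List Label} {s : Label × Shape}
    (h : state (i :: w) = some s) : act w i = i :: w := by
  rcases w with _ | ⟨l, _ | ⟨m, _ | ⟨k, w⟩⟩⟩ <;> simp [act, h]

theorem next_ne_root {s s' : Label × Shape} {i : Label} (h : next s i = some s') :
    s'.2 ≠ .root := by
  have key : ∀ (t : Shape) (k : Fin 8), t.step k ≠ some .root := by decide
  simp only [next, Option.map_eq_some_iff] at h
  obtain ⟨t, ht, rfl⟩ := h
  exact fun h₀ => key _ _ (ht.trans (congrArg some h₀))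

theorem next_back : ∀ (d : Label) (t : Shape), t ≠ .root → next (d, t) d = none := by
  decide

theorem act_inv_cons {l : Label} {w : List Label} {s : Label × Shape}
    (h : state (l :: w) = some s) : act (l :: w) l.inv = w := by
  obtain ⟨s₀, -, h₁⟩ := state_cons h
  have hn : state (l.inv :: l :: w) = none := by
    rw [state_cons_of h, ← next_fst h₁]
    exact next_back _ _ (next_ne_root h₁)
  rcases w with _ | ⟨m, _ | ⟨k, w⟩⟩ <;> simp [act, hn]

/-! ### Reading the sides of an octagon off a normal form -/

theorem next_eq_left2 : ∀ (s : Label × Shape) (i d : Label), next s i = some (d, .left2) →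
    d = i.inv ∧ ((i = s.1 + 1 ∧ (s.2 = .mid ∨ s.2 = .right2 ∨ s.2 = .right3)) ∨
      (i = s.1 + 2 ∧ s.2 = .top)) := by
  decide

theorem next_eq_left3 : ∀ (s : Label × Shape) (i d : Label), next s i = some (d, .left3) →
    d = i.inv ∧ i = s.1 + 1 ∧ s.2 = .left2 := by
  decide

theorem next_eq_top : ∀ (s : Label × Shape) (i d : Label), next s i = some (d, .top) →
    d = i.inv ∧ i = s.1 + 1 ∧ s.2 = .left3 := by
  decide

theorem next_eq_right3 : ∀ (s : Label × Shape) (i d : Label), next s i = some (d, .right3) →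
    d = i.inv ∧ i = s.1 - 1 ∧ s.2 = .right2 := by
  decide

theorem next_eq_right2 : ∀ (s : Label × Shape) (i d : Label), next s i = some (d, .right2) →
    d = i.inv ∧ i = s.1 - 1 ∧ (s.2 = .mid ∨ s.2 = .left2 ∨ s.2 = .left3 ∨ s.2 = .top) := by
  decide

theorem next_eq_none : ∀ (s : Label × Shape) (i : Label), next s i = none →
    (s.2 ≠ .root ∧ i = s.1) ∨ (s.2 = .top ∧ i = s.1 + 1) ∨ (s.2 = .right3 ∧ i = s.1 - 1) := by
  decide

/-- A normal form of shape `top` ends in three steps along the left side of an octagon. -/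
theorem state_eq_top {w : List Label} {d : Label} (h : state w = some (d, .top)) :
    ∃ k z s, w = k.left.left :: k.left :: k :: z ∧ d + 1 = k.left.left.left ∧
      state z = some s ∧ ((k = s.1 + 1 ∧ (s.2 = .mid ∨ s.2 = .right2 ∨ s.2 = .right3)) ∨
      (k = s.1 + 2 ∧ s.2 = .top)) := by
  rcases w with _ | ⟨l, w⟩
  · simp [state] at h
  obtain ⟨⟨d₁, t₁⟩, h₁, e₁⟩ := state_cons h
  obtain ⟨rfl, rfl, rfl⟩ := next_eq_top _ _ _ e₁
  rcases w with _ | ⟨m, w⟩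
  · simp [state] at h₁
  obtain ⟨⟨d₂, t₂⟩, h₂, e₂⟩ := state_cons h₁
  obtain ⟨rfl, rfl, rfl⟩ := next_eq_left3 _ _ _ e₂
  rcases w with _ | ⟨k, w⟩
  · simp [state] at h₂
  obtain ⟨s, h₃, e₃⟩ := state_cons h₂
  obtain ⟨rfl, h₄⟩ := next_eq_left2 _ _ _ e₃
  exact ⟨k, w, s, rfl, rfl, h₃, h₄⟩

/-- A normal form of shape `right3` ends in three steps along the right side of an octagon. -/
theorem state_eq_right3 {w : List Label} {d : Label} (h : state w = some (d, .right3)) :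
    ∃ k z t, w = k.right.right :: k.right :: k :: z ∧ d - 1 = k.right.right.right ∧
      state (k :: z) = some (k.inv, t) ∧
      (t = .mid ∨ t = .left2 ∨ t = .left3 ∨ t = .top) := by
  rcases w with _ | ⟨l, w⟩
  · simp [state] at h
  obtain ⟨⟨d₁, t₁⟩, h₁, e₁⟩ := state_cons h
  obtain ⟨rfl, rfl, rfl⟩ := next_eq_right3 _ _ _ e₁
  rcases w with _ | ⟨m, w⟩
  · simp [state] at h₁
  obtain ⟨⟨d₂, t₂⟩, h₂, e₂⟩ := state_cons h₁
  obtain ⟨rfl, rfl, ht⟩ := next_eq_right2 _ _ _ e₂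
  rcases w with _ | ⟨k, w⟩
  · simp [state] at h₂
    simp [h₂.2.symm] at ht
  obtain ⟨s, h₃, e₃⟩ := state_cons h₂
  obtain rfl := next_fst e₃
  exact ⟨k, w, t₂, rfl, rfl, h₂, ht⟩

theorem next_top_left : ∀ k : Label, next (k.left.left.inv, .top) k.left.left.left = none := by
  decide

theorem act_top {k : Label} {z : List Label} {d : Label}
    (h : state (k.left.left :: k.left :: k :: z) = some (d, .top)) :
    act (k.left.left :: k.left :: k :: z) k.left.left.left =
      (k - 1).right.right.right :: (k - 1).right.right :: (k - 1).right :: act z (k - 1) := by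
  obtain ⟨s₀, -, h₁⟩ := state_cons h
  obtain rfl : d = _ := next_fst h₁
  have hn : state (k.left.left.left :: k.left.left :: k.left :: k :: z) = none := by
    rw [state_cons_of h, next_top_left]
  have h2 : ∀ j : Label, j.left ≠ j.inv := by decide
  simp only [act, hn, h2]
  simp [Label.left]

theorem next_right3_right :
    ∀ k : Label, next (k.right.right.inv, .right3) k.right.right.right = none := by
  decide

theorem act_right3 {k : Label} {z : List Label} {d : Label}
    (h : state (k.right.right :: k.right :: k :: z) = some (d, .right3)) :
    act (k.right.right :: k.right :: k :: z) k.right.right.right =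
      (k + 1).left.left.left :: (k + 1).left.left :: (k + 1).left :: act z (k + 1) := by
  obtain ⟨s₀, -, h₁⟩ := state_cons h
  obtain rfl : d = _ := next_fst h₁
  have hn : state (k.right.right.right :: k.right.right :: k.right :: k :: z) = none := by
    rw [state_cons_of h, next_right3_right]
  have h2 : ∀ j : Label, j.right ≠ j.inv ∧ j.right ≠ j.inv + 1 := by decide
  simp [act, hn, h2]

/-- Walking up the left side of an octagon, from a vertex at height one. -/
theorem state_left_side {w : List Label} {s : Label × Shape} {c : Label} (hw : state w = some s)
    (hs : (s.1 = c.inv ∧ (s.2 = .mid ∨ s.2 = .right2 ∨ s.2 = .right3)) ∨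
      (s.1 + 1 = c.inv ∧ s.2 = .top)) :
    state (c.left :: w) = some (c.left.inv, .left2) ∧
    state (c.left.left :: c.left :: w) = some (c.left.left.inv, .left3) ∧
    state (c.left.left.left :: c.left.left :: c.left :: w) =
      some (c.left.left.left.inv, .top) := by
  have key : ∀ (s : Label × Shape) (c : Label),
      ((s.1 = c.inv ∧ (s.2 = .mid ∨ s.2 = .right2 ∨ s.2 = .right3)) ∨
        (s.1 + 1 = c.inv ∧ s.2 = .top)) → next s c.left = some (c.left.inv, .left2) := by
    decide
  have h2 : ∀ c : Label, next (c.inv, .left2) c.left = some (c.left.inv, .left3) := by decide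
  have h3 : ∀ c : Label, next (c.inv, .left3) c.left = some (c.left.inv, .top) := by decide
  have e₁ := (state_cons_of hw).trans (key s c hs)
  have e₂ := (state_cons_of e₁).trans (h2 _)
  exact ⟨e₁, e₂, (state_cons_of e₂).trans (h3 _)⟩

/-- Walking up the right side of an octagon, from a vertex at height one. -/
theorem state_right_side {w : List Label} {t : Shape} {c : Label}
    (hw : state w = some (c.inv, t)) (ht : t = .mid ∨ t = .left2 ∨ t = .left3 ∨ t = .top) :
    state (c.right :: w) = some (c.right.inv, .right2) ∧
    state (c.right.right :: c.right :: w) = some (c.right.right.inv, .right3) := by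
  have key : ∀ (t : Shape) (c : Label), (t = .mid ∨ t = .left2 ∨ t = .left3 ∨ t = .top) →
      next (c.inv, t) c.right = some (c.right.inv, .right2) := by
    decide
  have h2 : ∀ c : Label, next (c.inv, .right2) c.right = some (c.right.inv, .right3) := by decide
  have e₁ := (state_cons_of hw).trans (key t c ht)
  exact ⟨e₁, (state_cons_of e₁).trans (h2 _)⟩

/-- At the lowest vertex the left side starts with `c.inv` and the right side with the preceding
label, `c.right`. -/
theorem next_right_of_left : ∀ (s : Label × Shape) (c : Label) (t : Shape),
    next s c.inv = some (c, t) → (t = .mid ∨ t = .right2 ∨ t = .right3) →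
    ∃ t', next s c.right = some (c.right.inv, t') ∧
      (t' = .mid ∨ t' = .left2 ∨ t' = .left3 ∨ t' = .top) := by
  decide

/-- Here `k` starts the right side of an octagon and `k + 1` its left side. The latter may itself be
a deleted edge of a neighbouring octagon; such chains are why `act` is recursive. -/
theorem next_left_of_right : ∀ (s : Label × Shape) (k : Label) (t : Shape),
    next s k = some (k.inv, t) → (t = .mid ∨ t = .left2 ∨ t = .left3 ∨ t = .top) →
    (s.2 = .right3 ∧ k + 1 = s.1 - 1) ∨
    (∃ t', next s (k + 1) = some ((k + 1).inv, t') ∧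
      (t' = .mid ∨ t' = .right2 ∨ t' = .right3)) := by
  decide

theorem next_right3_right_of_inv : ∀ d c : Label, d - 1 = c.inv →
    next (d, .right3) c.right = some (c.right.inv, .mid) := by
  decide

/-! ### Crossing the deleted edges -/

/-- Going down the second downward edge of a vertex of shape `top`. -/
def DescendsFromTop (w : List Label) : Prop :=
  ∀ d, state w = some (d, .top) →
    (∃ d', state (act w (d + 1)) = some (d', .right3) ∧ d' - 1 = (d + 1).inv) ∧
    (act w (d + 1)).length + 1 = w.length

/-- Going up from a vertex of shape `right3` to the vertex of shape `top` on its right octagon. -/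
def AscendsToTop (w : List Label) : Prop :=
  ∀ d, state w = some (d, .right3) →
    (∃ d', state (act w (d - 1)) = some (d', .top) ∧ d' + 1 = (d - 1).inv) ∧
    (act w (d - 1)).length = w.length + 1

theorem descendsFromTop_cons {k : Label} {z : List Label} (hz : DescendsFromTop z) :
    DescendsFromTop (k.left.left :: k.left :: k :: z) := by
  intro d h
  obtain ⟨k', z', s, e, hd, hs, hk⟩ := state_eq_top h
  simp only [List.cons.injEq] at e
  obtain ⟨-, -, rfl, rfl⟩ := e
  rw [hd, act_top h]
  have lab : ∀ k : Label,
      (k - 1).right.right.right.inv - 1 = k.left.left.left.inv := by decide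
  suffices ∃ t', state ((k - 1).right :: act z (k - 1)) = some ((k - 1).right.inv, t') ∧
      (t' = .mid ∨ t' = .left2 ∨ t' = .left3 ∨ t' = .top) ∧
      (act z (k - 1)).length + 1 = z.length by
    obtain ⟨t', h₁, ht, hl⟩ := this
    exact ⟨⟨_, (state_right_side h₁ ht).2, lab k⟩, by simp; omega⟩
  -- The vertex at height one reaches the lowest vertex through its tree edge or, if it is itself a
  -- `top`, through its second downward edge; only the latter needs induction.
  rcases hk with ⟨hk, ht⟩ | ⟨hk, ht⟩
  · obtain rfl | ⟨l, u, rfl⟩ : z = [] ∨ ∃ l u, z = l :: u := by cases z <;> simp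
    · simp only [state, Option.some.injEq] at hs
      simp [← hs] at ht
    obtain ⟨s₀, h₀, h₁⟩ := state_cons hs
    have e₁ : k - 1 = l.inv := by rw [hk, next_fst h₁]; simp
    have e₂ : s = (k - 1, s.2) := by rw [e₁, ← next_fst h₁]
    have e₃ : l = (k - 1).inv := by rw [e₁, inv_inv]
    rw [e₃, e₂] at h₁
    obtain ⟨t', h₂, ht'⟩ := next_right_of_left _ _ _ h₁ ht
    have e₄ : act (l :: u) (k - 1) = u := by rw [e₁]; exact act_inv_cons hs
    rw [e₄]
    exact ⟨t', (state_cons_of h₀).trans h₂, ht', rfl⟩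
  · have e₁ : k - 1 = s.1 + 1 := by rw [hk]; exact (by decide : ∀ d : Label, d + 2 - 1 = d + 1) _
    have hs' : state z = some (s.1, .top) := by rw [← ht]; exact hs
    obtain ⟨⟨d', h₁, h₂⟩, hl⟩ := hz _ hs'
    rw [← e₁] at h₁ h₂ hl
    exact ⟨.mid, (state_cons_of h₁).trans (next_right3_right_of_inv _ _ h₂), by simp, hl⟩

theorem ascendsToTop_cons {k : Label} {z : List Label} (hz : AscendsToTop z) :
    AscendsToTop (k.right.right :: k.right :: k :: z) := by
  intro d h
  obtain ⟨k', z', t, e, hd, hs, ht⟩ := state_eq_right3 h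
  simp only [List.cons.injEq] at e
  obtain ⟨-, -, rfl, rfl⟩ := e
  rw [hd, act_right3 h]
  have lab : ∀ k : Label,
      (k + 1).left.left.left.inv + 1 = k.right.right.right.inv := by decide
  suffices ∃ s, state (act z (k + 1)) = some s ∧
      ((s.1 = (k + 1).inv ∧ (s.2 = .mid ∨ s.2 = .right2 ∨ s.2 = .right3)) ∨
      (s.1 + 1 = (k + 1).inv ∧ s.2 = .top)) ∧
      (act z (k + 1)).length = z.length + 1 by
    obtain ⟨s, h₁, hs, hl⟩ := this
    exact ⟨⟨_, (state_left_side h₁ hs).2.2, lab k⟩, by simp; omega⟩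
  obtain ⟨s₀, h₀, h₁⟩ := state_cons hs
  rcases next_left_of_right _ _ _ h₁ ht with ⟨hr, e₁⟩ | ⟨t', h₂, ht'⟩
  · have h₀' : state z = some (s₀.1, .right3) := by rw [← hr]; exact h₀
    obtain ⟨⟨d', h₂, h₃⟩, hl⟩ := hz _ h₀'
    rw [← e₁] at h₂ h₃ hl
    exact ⟨_, h₂, Or.inr ⟨h₃, rfl⟩, hl⟩
  · have h₃ := (state_cons_of h₀).trans h₂
    rw [act_of_state h₃]
    exact ⟨_, h₃, Or.inl ⟨rfl, ht'⟩, rfl⟩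

theorem descendsFromTop (w : List Label) : DescendsFromTop w := by
  induction hn : w.length using Nat.strong_induction_on generalizing w with
  | _ n ih =>
    intro d h
    obtain ⟨k, z, s, rfl, -⟩ := state_eq_top h
    exact descendsFromTop_cons (ih z.length (by simp at hn; omega) z rfl) d h

theorem ascendsToTop (w : List Label) : AscendsToTop w := by
  induction hn : w.length using Nat.strong_induction_on generalizing w with
  | _ n ih =>
    intro d h
    obtain ⟨k, z, s, rfl, -⟩ := state_eq_right3 h
    exact ascendsToTop_cons (ih z.length (by simp at hn; omega) z rfl) d h

/-- The four ways in which a label can act on a normal form. -/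
theorem act_cases {w : List Label} {s : Label × Shape} (h : state w = some s) (i : Label) :
    (∃ s', state (i :: w) = some s') ∨ (∃ z, w = i.inv :: z) ∨
    (s.2 = .top ∧ i = s.1 + 1) ∨ (s.2 = .right3 ∧ i = s.1 - 1) := by
  rcases hn : next s i with _ | s'
  · rcases next_eq_none _ _ hn with ⟨h₁, rfl⟩ | h₁ | h₁
    · rcases w with _ | ⟨l, z⟩
      · simp only [state, Option.some.injEq] at h
        simp [← h] at h₁
      · obtain ⟨s₀, -, h₂⟩ := state_cons h
        exact Or.inr (Or.inl ⟨z, by rw [next_fst h₂, inv_inv]⟩)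
    · exact Or.inr (Or.inr (Or.inl h₁))
    · exact Or.inr (Or.inr (Or.inr h₁))
  · exact Or.inl ⟨s', (state_cons_of h).trans hn⟩

theorem state_act {w : List Label} (h : (state w).isSome) (i : Label) :
    (state (act w i)).isSome := by
  obtain ⟨s, hs⟩ := Option.isSome_iff_exists.1 h
  rcases act_cases hs i with ⟨s', h₁⟩ | ⟨z, rfl⟩ | ⟨h₁, rfl⟩ | ⟨h₁, rfl⟩
  · simp [act_of_state h₁, h₁]
  · obtain ⟨s₀, h₀, -⟩ := state_cons hs
    have := act_inv_cons hs
    rw [inv_inv] at this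
    simp [this, h₀]
  · obtain ⟨⟨d', h₂, -⟩, -⟩ := descendsFromTop w s.1 (by rw [hs, ← h₁])
    simp [h₂]
  · obtain ⟨⟨d', h₂, -⟩, -⟩ := ascendsToTop w s.1 (by rw [hs, ← h₁])
    simp [h₂]

theorem length_act_le {w : List Label} (h : (state w).isSome) (i : Label) :
    (act w i).length ≤ w.length + 1 := by
  obtain ⟨s, hs⟩ := Option.isSome_iff_exists.1 h
  rcases act_cases hs i with ⟨s', h₁⟩ | ⟨z, rfl⟩ | ⟨h₁, rfl⟩ | ⟨h₁, rfl⟩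
  · simp [act_of_state h₁]
  · have := act_inv_cons hs
    rw [inv_inv] at this
    simp [this]
    omega
  · have := (descendsFromTop w s.1 (by rw [hs, ← h₁])).2
    omega
  · exact (ascendsToTop w s.1 (by rw [hs, ← h₁])).2.le

theorem act_act_inv {w : List Label} (h : (state w).isSome) (i : Label) :
    act (act w i) i.inv = w := by
  induction hn : w.length using Nat.strong_induction_on generalizing w i with
  | _ n ih =>
  obtain ⟨s, hs⟩ := Option.isSome_iff_exists.1 h
  rcases act_cases hs i with ⟨s', h₁⟩ | ⟨z, rfl⟩ | ⟨h₁, rfl⟩ | ⟨h₁, rfl⟩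
  · rw [act_of_state h₁, act_inv_cons h₁]
  · have := act_inv_cons hs
    rw [inv_inv] at this
    rw [this, act_of_state hs]
  · have hs' : state w = some (s.1, .top) := by rw [hs, ← h₁]
    obtain ⟨⟨d', h₂, h₃⟩, -⟩ := descendsFromTop w s.1 hs'
    obtain ⟨k, z, s₁, rfl, hd, hz, -⟩ := state_eq_top hs'
    have lab : ∀ k : Label, k.left.left.left.inv = (k - 1).right.right.right.right ∧
        (k - 1).right + 1 = (k - 1).inv ∧ (k - 1).inv.left = k := by decide
    rw [hd, act_top hs'] at h₂ ⊢
    -- The two exchanges of sides cancel, leaving a step and its inverse on the shorter word `z`.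
    rw [(lab k).1, act_right3 h₂, (lab k).2.1,
      ih z.length (by simp at hn; omega) (by simp [hz]) _ rfl, (lab k).2.2]
  · have hs' : state w = some (s.1, .right3) := by rw [hs, ← h₁]
    obtain ⟨⟨d', h₂, h₃⟩, -⟩ := ascendsToTop w s.1 hs'
    obtain ⟨k, z, t, rfl, hd, hz, -⟩ := state_eq_right3 hs'
    obtain ⟨s₀, h₀, -⟩ := state_cons hz
    have lab : ∀ k : Label, k.right.right.right.inv = (k + 1).left.left.left.left ∧
        (k + 1).left - 1 = (k + 1).inv ∧ (k + 1).inv.right = k := by decide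
    rw [hd, act_right3 hs'] at h₂ ⊢
    rw [(lab k).1, act_top h₂, (lab k).2.1,
      ih z.length (by simp at hn; omega) (by simp [h₀]) _ rfl, (lab k).2.2]

/-! ### Permutations of normal forms and closing up of octagons -/

/-- The words accepted by the automaton. -/
abbrev NormalForm : Type := {w : List Label // (state w).isSome}

/-- Right multiplication by a label as a permutation of the normal forms. -/
def actPerm (i : Label) : Equiv.Perm NormalForm where
  toFun w := ⟨act w.1 i, state_act w.2 i⟩
  invFun w := ⟨act w.1 i.inv, state_act w.2 i.inv⟩
  left_inv w := Subtype.ext (act_act_inv w.2 i)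
  right_inv w := Subtype.ext (by simpa [inv_inv] using act_act_inv w.2 i.inv)

theorem actPerm_inv (i : Label) : actPerm i.inv = (actPerm i)⁻¹ := by
  ext1 w
  rfl

/-- One step along an octagon, keeping it on the left. -/
def walk : Equiv.Perm (NormalForm × Label) where
  toFun p := (actPerm p.2 p.1, p.2.left)
  invFun p := (actPerm (p.2 - 1) p.1, (p.2 - 1).inv)
  left_inv p := by
    have : p.2.left - 1 = p.2.inv := by simp [Label.left]
    simp [this, actPerm_inv, inv_inv]
  right_inv p := by
    simp [actPerm_inv, inv_inv, Label.left]

/-- The labels of the edges that lead from a vertex in a given state towards the root. -/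
def Down (s : Label × Shape) (i : Label) : Prop :=
  (s.2 ≠ .root ∧ i = s.1) ∨ (s.2 = .top ∧ i = s.1 + 1)

instance (s : Label × Shape) (i : Label) : Decidable (Down s i) := by
  unfold Down; infer_instance

theorem length_act_of_down {w : List Label} {s : Label × Shape} {i : Label}
    (hs : state w = some s) (hi : Down s i) : (act w i).length + 1 = w.length := by
  rcases hi with ⟨h, rfl⟩ | ⟨h, rfl⟩
  · rcases w with _ | ⟨l, z⟩
    · simp only [state, Option.some.injEq] at hs
      simp [← hs] at h
    · obtain ⟨s₀, -, h₁⟩ := state_cons hs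
      rw [next_fst h₁, act_inv_cons hs, List.length_cons]
  · exact (descendsFromTop w s.1 (by rw [hs, ← h])).2

/-- If neither edge of a corner descends, the vertex is the lowest one of the octagon in that
corner. -/
theorem next_of_corner : ∀ (s : Label × Shape) (i : Label), ¬ Down s i → ¬ Down s (i - 1) →
    (∃ t, next s (i - 1) = some ((i - 1).inv, t) ∧
      (t = .mid ∨ t = .left2 ∨ t = .left3 ∨ t = .top)) ∧
    ((s.2 = .right3 ∧ i = s.1 - 1) ∨
      ∃ t, next s i = some (i.inv, t) ∧ (t = .mid ∨ t = .right2 ∨ t = .right3)) := by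
  decide

theorem act_octagon {w : List Label} {s : Label × Shape} {i : Label}
    (hs : state w = some s) (h₁ : ¬ Down s i) (h₂ : ¬ Down s (i - 1)) :
    act (act (act (act w i) i.left) i.left.left) i.left.left.left =
      act (act (act (act w (i - 1)) (i - 1).right) (i - 1).right.right)
        (i - 1).right.right.right := by
  obtain ⟨⟨t, e₁, ht⟩, hl⟩ := next_of_corner s i h₁ h₂
  have f₁ := (state_cons_of hs).trans e₁
  obtain ⟨f₂, f₃⟩ := state_right_side f₁ ht
  rw [act_of_state f₁, act_of_state f₂, act_of_state f₃, act_right3 f₃, sub_add_cancel]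
  suffices ∃ s', state (act w i) = some s' ∧
      ((s'.1 = i.inv ∧ (s'.2 = .mid ∨ s'.2 = .right2 ∨ s'.2 = .right3)) ∨
      (s'.1 + 1 = i.inv ∧ s'.2 = .top)) by
    obtain ⟨s', g, hs'⟩ := this
    obtain ⟨g₁, g₂, g₃⟩ := state_left_side g hs'
    rw [act_of_state g₁, act_of_state g₂, act_of_state g₃]
  rcases hl with ⟨h, rfl⟩ | ⟨t', e, ht'⟩
  · obtain ⟨⟨d', h₃, h₄⟩, -⟩ := ascendsToTop w s.1 (by rw [hs, ← h])
    exact ⟨_, h₃, Or.inr ⟨h₄, rfl⟩⟩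
  · have h₃ := (state_cons_of hs).trans e
    rw [act_of_state h₃]
    exact ⟨_, h₃, Or.inl ⟨rfl, ht'⟩⟩

theorem walk_pow_eight (p : NormalForm × Label) : (walk ^ 8) p = p := by
  induction hn : p.1.1.length using Nat.strong_induction_on generalizing p with
  | _ n ih =>
  obtain ⟨⟨w, hw⟩, i⟩ := p
  obtain ⟨s, hs⟩ := Option.isSome_iff_exists.1 hw
  simp only at hn
  -- The claim is invariant under moving along the octagon, so a descending edge, forwards or
  -- backwards, reduces it to a shorter word.
  by_cases h₁ : Down s i
  · have := length_act_of_down hs h₁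
    have := ih _ (by simp only [walk, actPerm, Equiv.coe_fn_mk]; omega) (walk (⟨w, hw⟩, i)) rfl
    rwa [← Equiv.Perm.mul_apply, ← pow_succ, pow_succ', Equiv.Perm.mul_apply,
      EmbeddingLike.apply_eq_iff_eq] at this
  by_cases h₂ : Down s (i - 1)
  · have := length_act_of_down hs h₂
    have := ih _ (by simp only [walk, actPerm, Equiv.Perm.inv_def, Equiv.coe_fn_symm_mk,
      Equiv.coe_fn_mk]; omega) (walk⁻¹ (⟨w, hw⟩, i)) rfl
    rwa [← Equiv.Perm.mul_apply, ← zpow_natCast, ← zpow_sub_one, sub_eq_neg_add, zpow_add,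
      zpow_neg_one, Equiv.Perm.mul_apply, EmbeddingLike.apply_eq_iff_eq] at this
  -- At the lowest vertex, four steps either way meet at the top.
  have key : (walk ^ 4) (⟨w, hw⟩, i) = ((walk⁻¹) ^ 4) (⟨w, hw⟩, i) := by
    have lab : ∀ i : Label, i.left.left.left.left = (i - 1).right.right.right.inv := by decide
    exact Prod.ext (Subtype.ext (act_octagon hs h₁ h₂)) (lab i)
  rw [show 8 = 4 + 4 from rfl, pow_add, Equiv.Perm.mul_apply, key,
    ← Equiv.Perm.mul_apply, inv_pow, mul_inv_cancel, Equiv.Perm.one_apply]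

/-! ### Normal forms and group elements -/

/-- The label of the outgoing edge for a generator. -/
def Gen.label : Gen → Label
  | a => 6
  | b => 1
  | c => 2
  | d => 5

/-- The group element of a label. -/
def Label.elt (i : Label) : SurfaceGroup :=
  ![(PresentedGroup.of Gen.a)⁻¹, PresentedGroup.of Gen.b, PresentedGroup.of Gen.c,
    (PresentedGroup.of Gen.d)⁻¹, (PresentedGroup.of Gen.c)⁻¹, PresentedGroup.of Gen.d,
    PresentedGroup.of Gen.a, (PresentedGroup.of Gen.b)⁻¹] i

theorem elt_label (s : Gen) : s.label.elt = PresentedGroup.of s := by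
  cases s <;> rfl

theorem elt_inv (i : Label) : i.inv.elt = (i.elt)⁻¹ := by
  fin_cases i <;> simp [Label.inv, Label.elt]

theorem elt_eq (i : Label) : ∃ s : Gen, i.elt = PresentedGroup.of s ∨
    i.elt = (PresentedGroup.of s)⁻¹ := by
  fin_cases i
  exacts [⟨.a, .inr rfl⟩, ⟨.b, .inl rfl⟩, ⟨.c, .inl rfl⟩, ⟨.d, .inr rfl⟩, ⟨.c, .inr rfl⟩,
    ⟨.d, .inl rfl⟩, ⟨.a, .inl rfl⟩, ⟨.b, .inr rfl⟩]

theorem relation : (PresentedGroup.of Gen.a : SurfaceGroup) * PresentedGroup.of Gen.b *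
    (PresentedGroup.of Gen.a)⁻¹ * (PresentedGroup.of Gen.b)⁻¹ * PresentedGroup.of Gen.c *
    PresentedGroup.of Gen.d * (PresentedGroup.of Gen.c)⁻¹ * (PresentedGroup.of Gen.d)⁻¹ = 1 :=
  PresentedGroup.one_of_mem (rels := {relator}) (Set.mem_singleton relator)

/-- The two sides of an octagon represent the same group element. -/
theorem elt_octagon (c : Label) :
    c.elt * c.left.elt * c.left.left.elt * c.left.left.left.elt =
      (c - 1).elt * (c - 1).right.elt * (c - 1).right.right.elt *
        (c - 1).right.right.right.elt := by
  -- The relator can be read from any of its letters, by cyclic conjugation starting at label 6,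
  -- which is `a`.
  have cyc : ∀ i : Label, i.elt * i.left.elt * i.left.left.elt * i.left.left.left.elt *
      i.left.left.left.left.elt * i.left.left.left.left.left.elt *
      i.left.left.left.left.left.left.elt * i.left.left.left.left.left.left.left.elt = 1 := by
    have step : ∀ i : Label, i.elt * i.left.elt * i.left.left.elt * i.left.left.left.elt *
        i.left.left.left.left.elt * i.left.left.left.left.left.elt *
        i.left.left.left.left.left.left.elt * i.left.left.left.left.left.left.left.elt = 1 →
        i.left.elt * i.left.left.elt * i.left.left.left.elt *
        i.left.left.left.left.elt * i.left.left.left.left.left.elt *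
        i.left.left.left.left.left.left.elt * i.left.left.left.left.left.left.left.elt *
        i.left.left.left.left.left.left.left.left.elt = 1 := by
      intro i h
      have h8 : i.left.left.left.left.left.left.left.left = i := 
        (by decide : ∀ i : Label, i.left.left.left.left.left.left.left.left = i) i
      rw [h8, mul_eq_one_iff_eq_inv, eq_comm, inv_eq_iff_mul_eq_one]
      simpa only [mul_assoc] using h
    have h0 : (6 : Label).elt * (6 : Label).left.elt * (6 : Label).left.left.elt *
      (6 : Label).left.left.left.elt * (6 : Label).left.left.left.left.elt *
      (6 : Label).left.left.left.left.left.elt * (6 : Label).left.left.left.left.left.left.elt *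
      (6 : Label).left.left.left.left.left.left.left.elt = 1 := relation
    have h1 := step _ h0
    have h2 := step _ h1
    have h3 := step _ h2
    have h4 := step _ h3
    have h5 := step _ h4
    have h6 := step _ h5
    have h7 := step _ h6
    intro i
    fin_cases i
    exacts [h2, h1, h4, h7, h6, h5, h0, h3]
  have lab : ∀ c : Label, c.left.left.left.left = (c - 1).right.right.right.inv ∧
      c.left.left.left.left.left = (c - 1).right.right.inv ∧
      c.left.left.left.left.left.left = (c - 1).right.inv ∧
      c.left.left.left.left.left.left.left = (c - 1).inv := by decide
  have h := cyc c
  obtain ⟨l₁, l₂, l₃, l₄⟩ := lab c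
  rw [l₄, l₃, l₂, l₁] at h
  simp only [elt_inv] at h
  rw [← mul_inv_eq_one, ← h]
  simp only [mul_inv_rev, mul_assoc]

/-- The group element that a word represents. -/
def eval : List Label → SurfaceGroup
  | [] => 1
  | i :: w => eval w * i.elt

theorem eval_act {w : List Label} (h : (state w).isSome) (i : Label) :
    eval (act w i) = eval w * i.elt := by
  induction hn : w.length using Nat.strong_induction_on generalizing w i with
  | _ n ih =>
  obtain ⟨s, hs⟩ := Option.isSome_iff_exists.1 h
  rcases act_cases hs i with ⟨s', h₁⟩ | ⟨z, rfl⟩ | ⟨h₁, rfl⟩ | ⟨h₁, rfl⟩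
  · rw [act_of_state h₁, eval]
  · have := act_inv_cons hs
    rw [inv_inv] at this
    simp [this, eval, elt_inv]
  · have hs' : state w = some (s.1, .top) := by rw [hs, ← h₁]
    obtain ⟨k, z, s₁, rfl, hd, hz, -⟩ := state_eq_top hs'
    rw [hd, act_top hs']
    have := elt_octagon k
    simp only [eval, ih z.length (by simp at hn; omega) (by simp [hz]) _ rfl]
    simp only [mul_assoc] at this ⊢
    rw [this]
  · have hs' : state w = some (s.1, .right3) := by rw [hs, ← h₁]
    obtain ⟨k, z, t, rfl, hd, hz, -⟩ := state_eq_right3 hs'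
    obtain ⟨s₀, h₀, -⟩ := state_cons hz
    rw [hd, act_right3 hs']
    have := elt_octagon (k + 1)
    rw [add_sub_cancel_right] at this
    simp only [eval, ih z.length (by simp at hn; omega) (by simp [h₀]) _ rfl]
    simp only [mul_assoc] at this ⊢
    rw [this]

/-- The group acts on normal forms, `g` acting as right multiplication by `g⁻¹`. -/
def actHom : SurfaceGroup →* Equiv.Perm NormalForm :=
  PresentedGroup.toGroup (f := fun s => (actPerm s.label)⁻¹) (by
    rintro r rfl
    have : actPerm (6 : Label).left.left.left.left.left.left.left *
        actPerm (6 : Label).left.left.left.left.left.left *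
        actPerm (6 : Label).left.left.left.left.left * actPerm (6 : Label).left.left.left.left *
        actPerm (6 : Label).left.left.left * actPerm (6 : Label).left.left *
        actPerm (6 : Label).left * actPerm 6 = 1 := by
      ext1 w
      exact congrArg Prod.fst (walk_pow_eight (w, 6))
    have h : actPerm (Label.inv 5) * actPerm (Label.inv 2) * actPerm 5 * actPerm 2 *
        actPerm (Label.inv 1) * actPerm (Label.inv 6) * actPerm 1 * actPerm 6 = 1 := this
    simp only [actPerm_inv] at h
    rw [← inv_eq_one, ← h]
    simp only [relator, map_mul, map_inv, FreeGroup.lift_apply_of, Gen.label, mul_inv_rev,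
      _root_.inv_inv, mul_assoc])

theorem actHom_elt (i : Label) : actHom i.elt = (actPerm i)⁻¹ := by
  have h : ∀ s : Gen, actHom (PresentedGroup.of s) = (actPerm s.label)⁻¹ :=
    fun s => PresentedGroup.toGroup.of _
  fin_cases i <;> simp only [Label.elt, Fin.zero_eta, Fin.mk_one, Fin.reduceFinMk] <;>
    simp [h, Gen.label, ← actPerm_inv] <;> simp [Label.inv]

/-- The empty word. -/
def NormalForm.nil : NormalForm := ⟨[], rfl⟩

/-- Injectivity of `eval`: a word is recovered from the element it represents by acting on the empty
word. -/
theorem actHom_eval_nil (w : NormalForm) : actHom (eval w.1)⁻¹ .nil = w := by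
  obtain ⟨w, hw⟩ := w
  induction w with
  | nil => simp [eval, NormalForm.nil]
  | cons i w ih =>
    obtain ⟨s, hs⟩ := Option.isSome_iff_exists.1 hw
    obtain ⟨s₀, h₀, -⟩ := state_cons hs
    have := ih (by simp [h₀])
    rw [eval, mul_inv_rev, map_mul, Equiv.Perm.mul_apply, this, map_inv, actHom_elt,
      _root_.inv_inv]
    exact Subtype.ext (act_of_state hs)

/-- Surjectivity of `eval` is the case of the empty word; general `w` is needed for the product
step. -/
theorem eval_actHom (g : SurfaceGroup) :
    ∀ w : NormalForm, eval (actHom g w).1 = eval w.1 * g⁻¹ := by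
  have gen : ∀ (i : Label) (w : NormalForm), eval (actHom i.elt w).1 = eval w.1 * i.elt⁻¹ := by
    intro i w
    rw [actHom_elt, ← actPerm_inv, ← elt_inv]
    exact eval_act w.2 _
  induction g using PresentedGroup.induction_on with
  | _ x =>
  induction x using FreeGroup.induction_on with
  | C1 => simp
  | of s =>
    intro w
    have := gen s.label w
    rw [elt_label] at this
    exact this
  | inv_of s h =>
    intro w
    have := gen s.label.inv w
    rw [elt_inv, elt_label] at this
    exact this
  | mul x y hx hy =>
    intro w
    rw [map_mul, map_mul, Equiv.Perm.mul_apply, hx, hy, mul_inv_rev, mul_assoc]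

/-- Every group element has exactly one normal form. -/
def evalEquiv : NormalForm ≃ SurfaceGroup where
  toFun w := eval w.1
  invFun g := actHom g⁻¹ .nil
  left_inv := actHom_eval_nil
  right_inv g := (eval_actHom g⁻¹ .nil).trans (by simp [NormalForm.nil, eval])

theorem evalEquiv_actPerm (w : NormalForm) (i : Label) :
    evalEquiv (actPerm i w) = evalEquiv w * i.elt :=
  eval_act w.2 i

/-! ### Snakes are determined by their endpoints -/

section Snake

variable {V : Type*} {Γ : SimpleGraph V} {u v v' : V}

theorem mem_snake_verts : v' ∈ (snake Γ u v).verts ↔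
    ∃ p : Γ.Walk u v, IsShortest p ∧ v' ∈ p.support := by
  simp [snake]

/-- The snake from `u` to `v` has only one vertex as far from `u` as `v`. -/
theorem eq_of_mem_snake {n : ℕ} (hv : ∃ p : Γ.Walk u v, IsShortest p ∧ p.length = n)
    (hv' : ∃ p : Γ.Walk u v', IsShortest p ∧ p.length = n) (h : v' ∈ (snake Γ u v).verts) :
    v' = v := by
  classical
  obtain ⟨p, hp, hmem⟩ := mem_snake_verts.1 h
  obtain ⟨q, -, rfl⟩ := hv
  obtain ⟨q', hq', hl⟩ := hv'
  by_contra hne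
  have h₁ := SimpleGraph.Walk.length_takeUntil_lt_length hmem hne
  have h₂ := hq' (p.takeUntil v' hmem)
  have h₃ := hp q
  omega

theorem end_mem_snake {n : ℕ} (hv : ∃ p : Γ.Walk u v, IsShortest p ∧ p.length = n) :
    v ∈ (snake Γ u v).verts := by
  obtain ⟨p, hp, -⟩ := hv
  exact mem_snake_verts.2 ⟨p, hp, p.end_mem_support⟩

/-- Snakes of length `n` correspond to the vertices at distance `n`. -/
noncomputable def sphereEquivSnakes (Γ : SimpleGraph V) (u : V) (n : ℕ) :
    {v : V // ∃ p : Γ.Walk u v, IsShortest p ∧ p.length = n} ≃ snakesFrom Γ u n :=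
  Equiv.ofBijective (fun v => ⟨snake Γ u v, v.1, v.2, rfl⟩) (by
    constructor
    · intro v v' h
      have h' : snake Γ u v = snake Γ u v' := congrArg Subtype.val h
      refine Subtype.ext (eq_of_mem_snake v'.2 v.2 ?_)
      rw [← h']
      exact end_mem_snake v.2
    · rintro ⟨H, v, hv, rfl⟩
      exact ⟨⟨v, hv⟩, rfl⟩)

end Snake

/-! ### Length of the normal form as distance -/

theorem exists_elt_of_adj {g h : SurfaceGroup} (hgh : cayleyGraph.Adj g h) :
    ∃ i : Label, h = g * i.elt := by
  obtain ⟨-, x, ⟨s, rfl⟩, hx | hx⟩ := (SimpleGraph.mulCayley_adj' _ _ _).1 hgh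
  · exact ⟨s.label, by rw [elt_label]; exact hx.symm⟩
  · refine ⟨s.label.inv, ?_⟩
    rw [elt_inv, elt_label, hx]
    simp

theorem adj_mul_elt {g : SurfaceGroup} {i : Label} (h : g ≠ g * i.elt) :
    cayleyGraph.Adj g (g * i.elt) := by
  refine (SimpleGraph.mulCayley_adj' _ _ _).2 ⟨h, ?_⟩
  obtain ⟨s, hs | hs⟩ := elt_eq i
  · exact ⟨_, ⟨s, rfl⟩, Or.inl (by rw [hs])⟩
  · exact ⟨_, ⟨s, rfl⟩, Or.inr (by rw [hs]; simp)⟩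

theorem length_le_of_walk {g h : SurfaceGroup} (p : cayleyGraph.Walk g h) :
    (evalEquiv.symm h).1.length ≤ (evalEquiv.symm g).1.length + p.length := by
  induction p with
  | nil => simp
  | @cons g g' h hadj p ih =>
    obtain ⟨i, rfl⟩ := exists_elt_of_adj hadj
    have e : evalEquiv.symm (g * i.elt) = actPerm i (evalEquiv.symm g) := by
      rw [Equiv.symm_apply_eq, evalEquiv_actPerm, Equiv.apply_symm_apply]
    have := length_act_le (evalEquiv.symm g).2 i
    rw [e] at ih
    change _ ≤ (act (evalEquiv.symm g).1 i).length + _ at ih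
    rw [SimpleGraph.Walk.length_cons]
    omega

theorem exists_walk (w : NormalForm) :
    ∃ p : cayleyGraph.Walk 1 (evalEquiv w), p.length = w.1.length := by
  obtain ⟨w, hw⟩ := w
  induction w with
  | nil => exact ⟨.nil, rfl⟩
  | cons i w ih =>
    obtain ⟨s, hs⟩ := Option.isSome_iff_exists.1 hw
    obtain ⟨s₀, h₀, -⟩ := state_cons hs
    obtain ⟨p, hp⟩ := ih (by simp [h₀])
    have hne : evalEquiv ⟨w, by simp [h₀]⟩ ≠ evalEquiv ⟨i :: w, hw⟩ := by simp
    exact ⟨p.concat (adj_mul_elt hne),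
      (SimpleGraph.Walk.length_concat p _).trans (congrArg (· + 1) hp)⟩

theorem evalEquiv_symm_one : evalEquiv.symm 1 = .nil := by
  rw [Equiv.symm_apply_eq]
  rfl

theorem shortest_iff (w : NormalForm) (n : ℕ) :
    (∃ p : cayleyGraph.Walk 1 (evalEquiv w), IsShortest p ∧ p.length = n) ↔ w.1.length = n := by
  have lower : ∀ p : cayleyGraph.Walk 1 (evalEquiv w), w.1.length ≤ p.length := fun p => by
    simpa [evalEquiv_symm_one, NormalForm.nil] using length_le_of_walk p
  obtain ⟨q, hq⟩ := exists_walk w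
  constructor
  · rintro ⟨p, hp, rfl⟩
    exact le_antisymm (lower p) (hq ▸ hp q)
  · rintro rfl
    exact ⟨q, fun p => hq ▸ lower p, hq⟩

/-- Snakes of length `n` correspond to the normal forms of length `n`. -/
noncomputable def normalFormsEquivSnakes (n : ℕ) :
    {w : NormalForm // w.1.length = n} ≃ snakesFrom cayleyGraph (1 : SurfaceGroup) n :=
  (evalEquiv.subtypeEquiv fun w => (shortest_iff w n).symm).trans (sphereEquivSnakes _ _ _)

/-! ### Counting normal forms by shape -/

theorem Shape.sum_univ (f : Shape → ℕ) : ∑ t, f t =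
    f .root + f .mid + f .left2 + f .left3 + f .top + f .right2 + f .right3 := by
  have : (Finset.univ : Finset Shape) =
    {.root, .mid, .left2, .left3, .top, .right2, .right3} := rfl
  rw [this]
  repeat rw [Finset.sum_insert (by decide)]
  rw [Finset.sum_singleton]
  ring

/-- The words of length `n` accepted by the automaton in a state of a given shape. -/
abbrev ShapedWord (n : ℕ) (t : Shape) : Type :=
  {w : List Label // w.length = n ∧ (state w).map Prod.snd = some t}

instance (n : ℕ) (t : Shape) : Finite (ShapedWord n t) :=
  Set.Finite.subset (List.finite_length_eq Label n) fun _ h => h.1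

/-- The number of edges of the spanning tree from a vertex of one shape to vertices of another. -/
def Shape.treeCount (t t' : Shape) : ℕ :=
  (Finset.univ.filter fun k : Fin 8 => t.step k = some t').card

/-- Subtracting the downward label only permutes the labels, so the count depends on the shape
alone. -/
theorem card_next (s : Label × Shape) (t : Shape) :
    Nat.card {i : Label // (next s i).map Prod.snd = some t} = s.2.treeCount t := by
  have : ∀ (s : Label × Shape) (t : Shape),
      Fintype.card {i : Label // (next s i).map Prod.snd = some t} = s.2.treeCount t := by
    decide
  rw [Nat.card_eq_fintype_card, this]

/-- A word is its last letter together with the rest. -/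
noncomputable def shapedWordEquiv (n : ℕ) (t' : Shape) :
    (Σ t, Σ w : ShapedWord n t, {i : Label // (state (i :: w.1)).map Prod.snd = some t'}) ≃
      ShapedWord (n + 1) t' :=
  Equiv.ofBijective (fun x => ⟨x.2.2.1 :: x.2.1.1, by simp [x.2.1.2.1], x.2.2.2⟩) (by
    constructor
    · rintro ⟨t, ⟨w, hw⟩, i, hi⟩ ⟨t₁, ⟨w₁, hw₁⟩, i₁, hi₁⟩ h
      simp only [Subtype.mk.injEq, List.cons.injEq] at h
      obtain ⟨rfl, rfl⟩ := h
      obtain rfl : t = t₁ := Option.some.inj (hw.2.symm.trans hw₁.2)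
      rfl
    · rintro ⟨_ | ⟨i, w⟩, hl, hs⟩
      · simp at hl
      · obtain ⟨s, h, rfl⟩ := Option.map_eq_some_iff.1 hs
        obtain ⟨s₀, h₀, -⟩ := state_cons h
        exact ⟨⟨s₀.2, ⟨w, by simpa using hl, by simp [h₀]⟩, i, hs⟩, rfl⟩)

theorem card_shapedWord_succ (n : ℕ) (t' : Shape) : Nat.card (ShapedWord (n + 1) t') =
    ∑ t : Shape, Nat.card (ShapedWord n t) * t.treeCount t' := by
  rw [← Nat.card_congr (shapedWordEquiv n t'), Nat.card_sigma]
  refine Finset.sum_congr rfl fun t _ => ?_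
  have := Fintype.ofFinite (ShapedWord n t)
  rw [Nat.card_sigma, Finset.sum_congr rfl (g := fun _ => t.treeCount t')]
  · simp [Nat.card_eq_fintype_card]
  · rintro ⟨w, hl, hw⟩ -
    obtain ⟨s, h, rfl⟩ := Option.map_eq_some_iff.1 hw
    simp only [state_cons_of h]
    exact card_next s t'

theorem card_shapedWord_zero (t : Shape) :
    Nat.card (ShapedWord 0 t) = if t = .root then 1 else 0 := by
  split_ifs with h
  · subst h
    rw [Nat.card_eq_one_iff_unique]
    exact ⟨⟨fun x y => Subtype.ext ((List.length_eq_zero_iff.1 x.2.1).trans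
      (List.length_eq_zero_iff.1 y.2.1).symm)⟩, ⟨⟨[], rfl, rfl⟩⟩⟩
  · have : IsEmpty (ShapedWord 0 t) := ⟨fun x => by
      obtain ⟨w, hl, hw⟩ := x
      obtain rfl := List.length_eq_zero_iff.1 hl
      exact h (Option.some.inj hw).symm⟩
    exact Nat.card_of_isEmpty

theorem card_normalForm (n : ℕ) : Nat.card {w : NormalForm // w.1.length = n} =
    ∑ t : Shape, Nat.card (ShapedWord n t) := by
  rw [← Nat.card_sigma]
  refine (Nat.card_congr (Equiv.ofBijective (fun x : Σ t, ShapedWord n t =>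
    (⟨⟨x.2.1, ?_⟩, x.2.2.1⟩ : {w : NormalForm // w.1.length = n})) ⟨?_, ?_⟩)).symm
  · obtain ⟨s, h, -⟩ := Option.map_eq_some_iff.1 x.2.2.2
    simp [h]
  · rintro ⟨t, w, hl, hw⟩ ⟨t₁, w₁, hl₁, hw₁⟩ h
    simp only [Subtype.mk.injEq] at h
    subst h
    obtain rfl : t = t₁ := Option.some.inj (hw.symm.trans hw₁)
    rfl
  · rintro ⟨⟨w, hw⟩, hl⟩
    obtain ⟨s, hs⟩ := Option.isSome_iff_exists.1 hw
    exact ⟨⟨s.2, w, hl, by simp [hs]⟩, rfl⟩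

instance finite_normalForm (n : ℕ) : Finite {w : NormalForm // w.1.length = n} :=
  have : Finite {l : List Label | l.length = n} := (List.finite_length_eq Label n).to_subtype
  Finite.of_injective (β := {l : List Label | l.length = n}) (fun w => ⟨w.1.1, w.2⟩)
    fun _ _ h => Subtype.ext (Subtype.ext (congrArg (fun l => l.1) h))

/-! ### Counting paths in `G₂` -/

namespace G₂

instance : Fintype G₂ where
  elems := ⟨{St, A, A', A'', B, C, C', D, E, Fi}, by simp⟩
  complete x := by cases x <;> simp

theorem sum_univ (f : G₂ → ℕ) : ∑ x, f x =
    f St + f A + f A' + f A'' + f B + f C + f C' + f D + f E + f Fi := by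
  have : ∑ x, f x = (Multiset.map f {St, A, A', A'', B, C, C', D, E, Fi}).sum := rfl
  rw [this]
  simp
  ring

/-- The directed paths of length `n` from `St` to `y`. -/
abbrev PathTo (n : ℕ) (y : G₂) : Type := {P : Quiver.Path St y // P.length = n}

instance (x y : G₂) : Fintype (x ⟶ y) := inferInstanceAs (Fintype (Fin (edgeCount x y)))

/-- A nonempty path is its last edge together with the rest. -/
noncomputable def pathToEquiv (n : ℕ) (y : G₂) :
    (Σ x, PathTo n x × (x ⟶ y)) ≃ PathTo (n + 1) y :=
  Equiv.ofBijective (fun P => ⟨P.2.1.1.cons P.2.2, by simp [P.2.1.2]⟩) (by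
    constructor
    · rintro ⟨x, ⟨P, hP⟩, e⟩ ⟨x₁, ⟨P₁, hP₁⟩, e₁⟩ h
      simp only [Subtype.mk.injEq, Quiver.Path.cons.injEq] at h
      obtain ⟨rfl, h₁, h₂⟩ := h
      obtain rfl := eq_of_heq h₁
      obtain rfl := eq_of_heq h₂
      rfl
    · rintro ⟨_ | ⟨P, e⟩, hP⟩
      · simp at hP
      · exact ⟨⟨_, ⟨P, by simpa using hP⟩, e⟩, rfl⟩)

theorem isEmpty_pathTo_zero {y : G₂} (hy : y ≠ St) : IsEmpty (PathTo 0 y) :=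
  ⟨fun P => hy (Quiver.Path.eq_of_length_zero P.1 P.2).symm⟩

instance : Unique (PathTo 0 St) where
  default := ⟨.nil, rfl⟩
  uniq P := Subtype.ext (Quiver.Path.eq_nil_of_length_zero P.1 P.2)

instance finite_pathTo (n : ℕ) (y : G₂) : Finite (PathTo n y) := by
  induction n generalizing y with
  | zero =>
    by_cases hy : y = St
    · subst hy; infer_instance
    · have := isEmpty_pathTo_zero hy; infer_instance
  | succ n ih => exact Finite.of_equiv _ (pathToEquiv n y)

theorem card_pathTo_succ (n : ℕ) (y : G₂) : Nat.card (PathTo (n + 1) y) =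
    ∑ x : G₂, Nat.card (PathTo n x) * edgeCount x y := by
  rw [← Nat.card_congr (pathToEquiv n y), Nat.card_sigma]
  refine Finset.sum_congr rfl fun x _ => ?_
  rw [Nat.card_prod]
  congr 1
  exact Nat.card_fin (edgeCount x y)

theorem card_pathTo_zero {y : G₂} (hy : y ≠ St) : Nat.card (PathTo 0 y) = 0 := by
  have := isEmpty_pathTo_zero hy
  exact Nat.card_of_isEmpty

end G₂

/-! ### Comparison of the two recursions -/

open G₂ in
/-- How the numbers of paths to the vertices of `G₂` and of normal forms of the various shapes
determine each other. -/
theorem card_pathTo_eq (n : ℕ) :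
    Nat.card (PathTo n St) = Nat.card (ShapedWord n .root) ∧
    Nat.card (PathTo n A) = Nat.card (ShapedWord n .mid) ∧
    Nat.card (PathTo n A') = Nat.card (ShapedWord n .left2) + Nat.card (ShapedWord n .right2) ∧
    Nat.card (PathTo n A'') = Nat.card (ShapedWord n .left3) + Nat.card (ShapedWord n .right3) ∧
    Nat.card (PathTo n D) = Nat.card (ShapedWord n .top) ∧
    Nat.card (ShapedWord n .left2) = Nat.card (ShapedWord n .right2) ∧
    Nat.card (ShapedWord n .left3) = Nat.card (ShapedWord n .right3) ∧
    Nat.card (PathTo n C') = Nat.card (ShapedWord n .left3) ∧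
    Nat.card (PathTo n C) = Nat.card (ShapedWord n .left2) ∧
    Nat.card (PathTo n E) = 2 * Nat.card (ShapedWord n .top) ∧
    Nat.card (PathTo n B) + Nat.card (ShapedWord n .top) = Nat.card (ShapedWord n .mid) +
      Nat.card (ShapedWord n .right2) + Nat.card (ShapedWord n .right3) := by
  induction n with
  | zero => simp [card_pathTo_zero, card_shapedWord_zero]
  | succ n ih =>
    have table : ∀ t t' : Shape, t.treeCount t' = match t, t' with
        | .root, .mid => 8
        | .root, _ => 0
        | .top, .mid => 4
        | _, .mid => 5
        | .left2, .left2 => 0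
        | .left3, .left2 => 0
        | _, .left2 => 1
        | .left2, .left3 => 1
        | .left3, .top => 1
        | .right2, .right2 => 0
        | .right3, .right2 => 0
        | _, .right2 => 1
        | .right2, .right3 => 1
        | _, _ => 0 := by
      decide
    -- The identity for `B` is forced by `C`: paths enter `C` from `B` or `E`, tree edges enter
    -- `left2` from `mid`, `right2`, `right3` or `top`, and `E` counts each `top` twice.
    simp only [card_pathTo_succ, card_shapedWord_succ, G₂.sum_univ, Shape.sum_univ, table,
      edgeCount]
    omega

/-- Exactly `St`, `A`, `A'`, `A''` and `D` have an edge to `Fi`, one each, and together they account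
for every shape once. -/
theorem card_pathTo_finish (n : ℕ) : Nat.card (G₂.PathTo (n + 1) .Fi) =
    ∑ t : Shape, Nat.card (ShapedWord n t) := by
  have := card_pathTo_eq n
  simp only [G₂.card_pathTo_succ, G₂.sum_univ, Shape.sum_univ, G₂.edgeCount]
  omega

end Snakes

theorem theorem2p1 (n : ℕ) :
    Nonempty
      (↥(Snakes.snakesFrom Snakes.cayleyGraph (1 : Snakes.SurfaceGroup) n) ≃
        {P : Quiver.Path Snakes.G₂.St Snakes.G₂.Fi // P.length = n + 1}) := by
  have h := (Snakes.card_normalForm n).trans (Snakes.card_pathTo_finish n).symm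
  exact (Finite.card_eq.1 h).map (Snakes.normalFormsEquivSnakes n).symm.trans
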